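/- Let $n\ge 3$, let $B_n=\langle \sigma_1,\dots,\sigma_{n-1} \mid \sigma_i\sigma_{i+1}\sigma_i=\sigma_{i+1}\sigma_i\sigma_{i+1},\ \sigma_i\sigma_j=\sigma_j\sigma_i \text{ for } |i-j|\ge 2\rangle$ be the braid group, and let $\Sigma_n$ be the symmetric group. A non-cyclic quotient of $B_n$ is a surjective homomorphism $f\colon B_n\to G$ onto a group $G$ that is not cyclic; it is minimal if there is no non-cyclic quotient of $B_n$ whose codomain has smaller cardinality. Let $s_n$ be the standard map $B_n\to\Sigma_n$, $\sigma_i\mapsto (i\ \ i{+}1)$, if $n\neq 4$, and let $s_4$ be the standard map $B_4\to\Sigma_3$, $\sigma_1,\sigma_3\mapsto(1\ 2)$, $\sigma_2\mapsto(2\ 3)$, if $n=4$. Then $s_n$ is a minimal non-cyclic quotient of $B_n$, and it is the only one up to isomorphism of the codomain: for every minimal non-cyclic quotient $f\colon B_n\to G$ there is an isomorphism $\varphi$ from $G$ to the codomain of $s_n$ with $\varphi\circ f=s_n$. If moreover $n\neq 6$, then every minimal non-cyclic quotient $f$ of $B_n$ whose codomain is that of $s_n$ is conjugate to $s_n$: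 there is an element $\tau$ of this codomain with $f(b)=\tau\, s_n(b)\,\tau^{-1}$ for all $b\in B_n$. -/

import Mathlib

universe u

/-- The Artin relations on the letters `σ_0, …, σ_{n-2}`: the braid relation for neighbouring
letters and commutation for letters at distance at least two. -/
def braidRelations (n : ℕ) : Set (FreeGroup (Fin (n - 1))) :=
  {r | ∃ i j : Fin (n - 1), (i : ℕ) + 1 = j ∧
      r = FreeGroup.of i * FreeGroup.of j * FreeGroup.of i *
        (FreeGroup.of j * FreeGroup.of i * FreeGroup.of j)⁻¹} ∪
  {r | ∃ i j : Fin (n - 1), (i : ℕ) + 1 < j ∧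
      r = FreeGroup.of i * FreeGroup.of j * (FreeGroup.of j * FreeGroup.of i)⁻¹}

/-- The braid group on `n` strands, by Artin's presentation. -/
abbrev BraidGroup (n : ℕ) : Type := PresentedGroup (braidRelations n)

namespace BraidGroup

/-- The half-twist generators; `σ i` is classically written `σ_{i+1}`. -/
def σ {n : ℕ} (i : Fin (n - 1)) : BraidGroup n := PresentedGroup.of i

/-- The homomorphism out of the braid group determined by elements satisfying the Artin
relations. -/
def lift {n : ℕ} {G : Type u} [Group G] (t : Fin (n - 1) → G)
    (hbraid : ∀ i j : Fin (n - 1), (i : ℕ) + 1 = j → t i * t j * t i = t j * t i * t j)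
    (hcomm : ∀ i j : Fin (n - 1), (i : ℕ) + 1 < j → t i * t j = t j * t i) :
    BraidGroup n →* G :=
  PresentedGroup.toGroup (f := t) (by
    rintro r (⟨i, j, hij, rfl⟩ | ⟨i, j, hij, rfl⟩)
    · simp only [map_mul, map_inv, FreeGroup.lift_apply_of]
      exact mul_inv_eq_one.2 (hbraid i j hij)
    · simp only [map_mul, map_inv, FreeGroup.lift_apply_of]
      exact mul_inv_eq_one.2 (hcomm i j hij))

theorem lift_σ {n : ℕ} {G : Type u} [Group G] (t : Fin (n - 1) → G)
    (hbraid : ∀ i j : Fin (n - 1), (i : ℕ) + 1 = j → t i * t j * t i = t j * t i * t j)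
    (hcomm : ∀ i j : Fin (n - 1), (i : ℕ) + 1 < j → t i * t j = t j * t i)
    (i : Fin (n - 1)) : lift t hbraid hcomm (σ i) = t i :=
  PresentedGroup.toGroup.of _

/-- The transposition of the `i`-th and the `(i+1)`-st of the `n` points. -/
def adjSwap {n : ℕ} (i : Fin (n - 1)) : Equiv.Perm (Fin n) :=
  Equiv.swap ⟨i, by omega⟩ ⟨i + 1, by omega⟩

theorem adjSwap_braid {n : ℕ} (i j : Fin (n - 1)) (h : (i : ℕ) + 1 = j) :
    adjSwap i * adjSwap j * adjSwap i = adjSwap j * adjSwap i * adjSwap j := by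
  ext x
  simp only [adjSwap, Equiv.Perm.mul_apply, Equiv.swap_apply_def]
  grind

theorem adjSwap_comm {n : ℕ} (i j : Fin (n - 1)) (h : (i : ℕ) + 1 < j) :
    adjSwap i * adjSwap j = adjSwap j * adjSwap i := by
  ext x
  simp only [adjSwap, Equiv.Perm.mul_apply, Equiv.swap_apply_def]
  grind

/-- The standard map `B_n → Σ_n`, sending each half-twist to the adjacent transposition. -/
def toPerm (n : ℕ) : BraidGroup n →* Equiv.Perm (Fin n) :=
  lift adjSwap adjSwap_braid adjSwap_comm

/-- The standard map `B_4 → Σ_3`, sending the first and third half-twist to `(1 2)` and the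
second to `(2 3)` (on the points `0, 1, 2`: to `(0 1)` and `(1 2)`). -/
def fourToPermThree : BraidGroup 4 →* Equiv.Perm (Fin 3) :=
  lift (n := 4) ![Equiv.swap 0 1, Equiv.swap 1 2, Equiv.swap 0 1] (by decide) (by decide)

end BraidGroup

/-- A non-cyclic quotient of `B`: a surjective homomorphism onto a group that is not cyclic. -/
def IsNoncyclicQuotient {B : Type} [Group B] {G : Type u} [Group G] (f : B →* G) : Prop :=
  Function.Surjective f ∧ ¬ IsCyclic G

/-- A minimal non-cyclic quotient: no non-cyclic quotient has a codomain of smaller cardinality.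
Letting `H` range over `Type` loses nothing, as each quotient of `B : Type` is isomorphic to
`B ⧸ N : Type` for some `N`. -/
def IsMinimalNoncyclicQuotient {B : Type} [Group B] {G : Type u} [Group G] (f : B →* G) : Prop :=
  IsNoncyclicQuotient f ∧
    ¬ ∃ (H : Type) (_ : Group H) (g : B →* H),
      IsNoncyclicQuotient g ∧ Cardinal.lift.{u} (Cardinal.mk H) < Cardinal.lift.{0} (Cardinal.mk G)

/-- Two quotient maps of `B` agree up to an isomorphism of their codomains. -/
def QuotientEquivalent {B : Type} [Group B] {G : Type u} [Group G] {S : Type} [Group S]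
    (f : B →* G) (s : B →* S) : Prop :=
  ∃ φ : G ≃* S, ∀ b : B, φ (f b) = s b

/-- Two homomorphisms with the same codomain are conjugate by an element of the codomain. -/
def HomConjugate {B : Type} [Group B] {S : Type} [Group S] (f s : B →* S) : Prop :=
  ∃ τ : S, ∀ b : B, f b = τ * s b * τ⁻¹

/-! Let `t` list the images of the N = n − 1 half-twists in a finite quotient G, and suppose first
that they are distinct, so that neighbours do not commute. Each pair of the points 0, …, N has a
band generator, conjugate to `t 0`. By `commute_arc_iff`, the `t m` that commute with it determine
the pair up to complement, so for N ≠ 3 these N(N + 1)/2 conjugates are distinct. The centralizer of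
`t 0` modulo the powers of `t 0` contains distinct images of `t 2`, `t 3`, …, and induction bounds
its order below by (N − 1)!. Orbit–stabilizer then gives n! · ord(`t 0`) ≤ 2|G|. Since ord(`t 0`) ≥
2, this yields n! ≤ |G|, with equality only if the generators are involutions. For N = 3 six
conjugates and a centralizer of order at least four are found by hand.

If two generators coincide, all do and G is cyclic, except that `t 0 = t 2` is possible for N = 3.
That exception is why Σ_3 replaces Σ_4 when n = 4: a minimal quotient of B_4 has order at most 6 <
24, so it satisfies `t 0 = t 2` and is determined on B_3.

For uniqueness, N involutions satisfying the Artin relations generate a group of order at most n!.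
Applied to the image of (f, s_n) in the product, this makes both projections bijective, and the
image is the graph of the isomorphism. For conjugacy, the order of its centralizer singles out a
transposition among involutions when n ≠ 6, and transpositions satisfying the Artin relations run
along a path whose vertices define τ. -/

/-! ### Band generators and their commutation with the half-twists -/

/-- The first `N` terms of `t` satisfy the Artin relations. -/
structure IsArtin {G : Type*} [Group G] (N : ℕ) (t : ℕ → G) : Prop where
  braid : ∀ i, i + 1 < N → t i * t (i + 1) * t i = t (i + 1) * t i * t (i + 1)
  comm : ∀ i j, i + 1 < j → j < N → Commute (t i) (t j)

/-- The band generator joining the points `i` and `i + k + 1`. -/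
def arc {G : Type*} [Group G] (t : ℕ → G) (i : ℕ) : ℕ → G
  | 0 => t i
  | k + 1 => t (i + k + 1) * arc t i k * (t (i + k + 1))⁻¹

theorem commute_conj_of_commute {G : Type*} [Group G] {a c x : G} (h : Commute a c) :
    Commute a (c * x * c⁻¹) ↔ Commute a x := by
  conv_lhs => rw [show a = c * a * c⁻¹ by rw [← h.eq]; group]
  exact Commute.conj_iff c

/-- This turns distinctness of neighbours into non-commutation, and commutation of neighbours into
coincidence. -/
theorem eq_of_braid_of_commute {G : Type*} [Group G] {a b : G}
    (h : a * b * a = b * a * b) (hc : Commute a b) : a = b := by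
  have h1 : a * b * a = a * b * b := by rw [h, ← hc.eq]
  exact mul_left_cancel h1

theorem conj_eq_inv_conj_of_braid {G : Type*} [Group G] {a b : G}
    (h : a * b * a = b * a * b) : b * a * b⁻¹ = a⁻¹ * b * a := by
  rw [mul_inv_eq_iff_eq_mul]
  calc b * a = a⁻¹ * (a * b * a) := by group
    _ = a⁻¹ * b * a * b := by rw [h]; group

theorem conj_mul_eq_of_braid {G : Type*} [Group G] {a b : G}
    (h : a * b * a = b * a * b) : (a * b) * a * (a * b)⁻¹ = b := by
  rw [h]; group

/-- The induction step for comparing two indicator functions: if they change together between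
consecutive points, agreement at one point is equivalent to agreement at the next. -/
theorem iff_transfer {A B C D E : Prop} (h : (A ↔ B) ↔ (C ↔ D)) (h' : (A ↔ C) ↔ E) :
    (B ↔ D) ↔ E := by
  by_cases A <;> by_cases B <;> by_cases C <;> simp_all

namespace IsArtin

variable {G : Type*} [Group G] {N : ℕ} {t : ℕ → G}

theorem map {H : Type*} [Group H] (h : IsArtin N t) (φ : G →* H) :
    IsArtin N (fun i => φ (t i)) where
  braid i hi := by simp only [← map_mul, h.braid i hi]
  comm i j hij hj := (h.comm i j hij hj).map φ

theorem shift (h : IsArtin N t) (k : ℕ) : IsArtin (N - k) (fun i => t (i + k)) where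
  braid i hi := by
    have := h.braid (i + k) (by omega)
    rwa [show i + k + 1 = i + 1 + k by omega] at this
  comm i j hij hj := h.comm _ _ (by omega) (by omega)

theorem commute_of_ne (h : IsArtin N t) {i j : ℕ} (hi : i < N) (hj : j < N) (h1 : i + 1 ≠ j)
    (h2 : j + 1 ≠ i) : Commute (t i) (t j) := by
  rcases lt_trichotomy i j with hij | rfl | hij
  · exact h.comm i j (by omega) hj
  · exact Commute.refl _
  · exact (h.comm j i (by omega) hi).symm

/-- A band generator can also be extended from its left end; this gives access to the commutation
behaviour there. -/
theorem arc_succ (h : IsArtin N t) (k : ℕ) : ∀ i, i + k + 1 < N →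
    arc t i (k + 1) = (t i)⁻¹ * arc t (i + 1) k * t i := by
  induction k with
  | zero => intro i hi; exact conj_eq_inv_conj_of_braid (h.braid i hi)
  | succ k ih =>
    intro i hi
    have hc := h.comm i (i + 1 + k + 1) (by omega) (by omega)
    have e : i + (k + 1) + 1 = i + 1 + k + 1 := by omega
    rw [arc, ih i (by omega), e, arc]
    have hc' := hc.inv_left.eq
    have hc'' := hc.inv_right.eq
    simp only [mul_assoc] at *
    rw [hc'', ← mul_assoc _ (t i)⁻¹, ← hc', mul_assoc]

theorem commute_arc_of_lt (h : IsArtin N t) {m i : ℕ} (hm : m + 1 < i) (k : ℕ) (hk : i + k < N) :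
    Commute (t m) (arc t i k) := by
  induction k with
  | zero => exact h.comm _ _ hm hk
  | succ k ih =>
    exact (commute_conj_of_commute (h.comm m (i + k + 1) (by omega) (by omega))).2 (ih (by omega))

theorem commute_arc_of_gt (h : IsArtin N t) {m i k : ℕ} (hm : i + k + 1 < m) (hmN : m < N) :
    Commute (t m) (arc t i k) := by
  induction k with
  | zero => exact (h.comm _ _ hm hmN).symm
  | succ k ih =>
    exact (commute_conj_of_commute (h.comm (i + k + 1) m (by omega) (by omega)).symm).2
      (ih (by omega))

theorem commute_arc_of_mem (h : IsArtin N t) {m i : ℕ} (hm : i < m) (k : ℕ) (hmk : m < i + k)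
    (hk : i + k < N) : Commute (t m) (arc t i k) := by
  induction k with
  | zero => omega
  | succ k ih =>
    by_cases hmk' : m < i + k
    · exact (commute_conj_of_commute (h.comm m (i + k + 1) (by omega) (by omega))).2
        (ih hmk' (by omega))
    · obtain ⟨l, rfl⟩ : ∃ l, k = l + 1 := ⟨k - 1, by omega⟩
      obtain rfl : m = i + l + 1 := by omega
      -- Conjugating by `t (i + l + 2) * t (i + l + 1)` carries this disjoint pair to `t (i + l +
      -- 1)` and the longer arc.
      have hc := h.commute_arc_of_gt (m := i + l + 2) (i := i) (k := l) (by omega) (by omega)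
      have hb := h.braid (i + l + 1) (by omega)
      have e : i + (l + 1) + 1 = i + l + 2 := by omega
      have e' : i + l + 1 + 1 = i + l + 2 := by omega
      rw [arc, arc, e]
      rw [e'] at hb
      have := (Commute.conj_iff (t (i + l + 2) * t (i + l + 1))).2 hc
      rw [conj_mul_eq_of_braid hb.symm] at this
      simpa only [mul_assoc, mul_inv_rev] using this

theorem not_commute_succ (h : IsArtin N t) (ht : Set.InjOn t (Set.Iio N)) {i : ℕ}
    (hi : i + 1 < N) : ¬ Commute (t i) (t (i + 1)) := fun hc => by
  have := ht (show i ∈ Set.Iio N by simp; omega) hi (eq_of_braid_of_commute (h.braid i hi) hc)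
  omega

theorem not_commute_arc_left (h : IsArtin N t) (ht : Set.InjOn t (Set.Iio N)) (i k : ℕ)
    (hk : i + 1 + k < N) : ¬ Commute (t i) (arc t (i + 1) k) := by
  induction k with
  | zero => exact h.not_commute_succ ht hk
  | succ k ih =>
    rw [arc, commute_conj_of_commute (h.comm i (i + 1 + k + 1) (by omega) (by omega))]
    exact ih (by omega)

theorem not_commute_arc_right (h : IsArtin N t) (ht : Set.InjOn t (Set.Iio N)) (k : ℕ) :
    ∀ i, i + k + 1 < N → ¬ Commute (t (i + k + 1)) (arc t i k) := by
  induction k with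
  | zero => exact fun i hi hc => h.not_commute_succ ht hi hc.symm
  | succ k ih =>
    intro i hi
    have hc := (h.comm i (i + (k + 1) + 1) (by omega) (by omega)).symm.inv_right
    have key := commute_conj_of_commute (x := arc t (i + 1) k) hc
    rw [inv_inv] at key
    rw [h.arc_succ k i (by omega), key]
    have := ih (i + 1) (by omega)
    rwa [show i + 1 + k + 1 = i + (k + 1) + 1 by omega] at this

theorem not_commute_arc_start (h : IsArtin N t) (ht : Set.InjOn t (Set.Iio N)) (i k : ℕ)
    (hk : i + k + 1 < N) : ¬ Commute (t i) (arc t i (k + 1)) := by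
  have key := commute_conj_of_commute (x := arc t (i + 1) k) (Commute.refl (t i)).inv_right
  rw [inv_inv] at key
  rw [h.arc_succ k i hk, key]
  exact h.not_commute_arc_left ht i k (by omega)

theorem not_commute_arc_end (h : IsArtin N t) (ht : Set.InjOn t (Set.Iio N)) (i k : ℕ)
    (hk : i + k + 1 < N) : ¬ Commute (t (i + k + 1)) (arc t i (k + 1)) := by
  rw [arc, commute_conj_of_commute (Commute.refl _)]
  exact h.not_commute_arc_right ht k i hk

/-- `t m` commutes with a band generator exactly when the edges share zero or two points. -/
theorem commute_arc_iff (h : IsArtin N t) (ht : Set.InjOn t (Set.Iio N)) {m i k : ℕ}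
    (hm : m < N) (hk : i + k < N) : Commute (t m) (arc t i k) ↔
      ((m = i ∨ m = i + k + 1) ↔ (m + 1 = i ∨ m + 1 = i + k + 1)) := by
  by_cases h1 : m + 1 < i
  · exact iff_of_true (h.commute_arc_of_lt h1 k hk) (by omega)
  by_cases h2 : i + k + 1 < m
  · exact iff_of_true (h.commute_arc_of_gt h2 hm) (by omega)
  by_cases h3 : i < m ∧ m < i + k
  · exact iff_of_true (h.commute_arc_of_mem h3.1 k h3.2 hk) (by omega)
  by_cases h4 : m + 1 = i
  · subst h4
    exact iff_of_false (h.not_commute_arc_left ht m k hk) (by omega)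
  by_cases h5 : m = i + k + 1
  · subst h5
    exact iff_of_false (h.not_commute_arc_right ht k i hm) (by omega)
  rcases k with _ | k
  · obtain rfl : m = i := by omega
    exact iff_of_true (Commute.refl _) (by omega)
  by_cases h6 : m = i
  · subst h6
    exact iff_of_false (h.not_commute_arc_start ht m k hk) (by omega)
  · obtain rfl : m = i + k + 1 := by omega
    exact iff_of_false (h.not_commute_arc_end ht i k hk) (by omega)

/-- Commutation with `t m` records whether `m` and `m + 1` are both in or both out of the pair of
endpoints. Hence it fixes the pair up to complement, and two pairs can be complementary only among
four points, that is, for N = 3. -/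
theorem arc_injective (h : IsArtin N t) (ht : Set.InjOn t (Set.Iio N)) (hN : N ≠ 3) (hN' : 2 ≤ N)
    {i k i' k' : ℕ} (hk : i + k < N) (hk' : i' + k' < N) (he : arc t i k = arc t i' k') :
    i = i' ∧ k = k' := by
  have key : ∀ m < N, ((m = i ∨ m = i + k + 1) ↔ (m + 1 = i ∨ m + 1 = i + k + 1)) ↔
      ((m = i' ∨ m = i' + k' + 1) ↔ (m + 1 = i' ∨ m + 1 = i' + k' + 1)) := fun m hm => by
    rw [← h.commute_arc_iff ht hm hk, ← h.commute_arc_iff ht hm hk', he]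
  have all : ∀ m ≤ N, ((m = i ∨ m = i + k + 1) ↔ (m = i' ∨ m = i' + k' + 1)) ↔
      ((0 = i ∨ 0 = i + k + 1) ↔ (0 = i' ∨ 0 = i' + k' + 1)) := by
    intro m
    induction m with
    | zero => intro _; rfl
    | succ m ih =>
      intro hm
      exact iff_transfer (key m (by omega)) (ih (by omega))
  by_cases hc : (0 = i ∨ 0 = i + k + 1) ↔ (0 = i' ∨ 0 = i' + k' + 1)
  · have a := (all i (by omega)).2 hc
    have b := (all (i + k + 1) (by omega)).2 hc
    omega
  · exfalso
    -- Here the pairs would be complementary, so the N + 1 points would number exactly four.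
    have no : ∀ m ≤ N, ¬ ((m = i ∨ m = i + k + 1) ↔ (m = i' ∨ m = i' + k' + 1)) :=
      fun m hm hcc => hc ((all m hm).1 hcc)
    clear key all hc he
    rcases Nat.lt_or_ge N 3 with hlt | hge
    · obtain rfl : N = 2 := by omega
      have := no 0; have := no 1; have := no 2
      omega
    · have hsub : Finset.range 5 ⊆ {i, i + k + 1, i', i' + k' + 1} := fun m hm => by
        have := no m (by have := Finset.mem_range.1 hm; omega)
        simp only [Finset.mem_insert, Finset.mem_singleton]
        tauto
      have := (Finset.card_le_card hsub).trans Finset.card_le_four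
      simp at this

end IsArtin

/-! ### Lower bounds from conjugacy classes and centralizers -/

theorem card_mul_card_centralizer_le {G : Type*} [Group G] [Finite G] (g : G) (S : Finset G)
    (hS : ∀ s ∈ S, IsConj g s) :
    S.card * Nat.card (Subgroup.centralizer {g}) ≤ Nat.card G := by
  rw [Subgroup.card_eq_card_quotient_mul_card_subgroup (Subgroup.centralizer {g})]
  refine Nat.mul_le_mul_right _ ?_
  choose! x hx using fun s hs => isConj_iff.1 (hS s hs)
  rw [← Nat.card_eq_finsetCard S]
  refine Nat.card_le_card_of_injective
    (fun s : S => (x s : G ⧸ Subgroup.centralizer {g})) fun s s' hss => Subtype.ext ?_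
  have h1 := Subgroup.mem_centralizer_singleton_iff.1 (QuotientGroup.eq.1 hss)
  rw [← hx s s.2, ← hx s' s'.2]
  have h2 : g * ((x s)⁻¹ * x s') = ((x s)⁻¹ * x s') * g := by
    exact h1.symm
  calc x s * g * (x s)⁻¹ = x s * (g * ((x s)⁻¹ * x s')) * (x s')⁻¹ := by group
    _ = _ := by rw [h2]; group

/-- The left side of the second relation contains `z` twice and the right side once. -/
theorem eq_one_of_braid_mul_central {G : Type*} [Group G] {a b z : G} (ha : Commute z a)
    (hb : Commute z b) (h : a * b * a = b * a * b)
    (hz : (a * z) * b * (a * z) = b * (a * z) * b) : z = 1 := by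
  have h1 : (a * z) * b * (a * z) = a * b * a * z * z := by
    simp only [mul_assoc, ← ha.eq]
    simp only [← mul_assoc, ha.eq]
    simp only [mul_assoc, ha.eq, hb.eq]
  have h2 : b * (a * z) * b = b * a * b * z := by simp only [mul_assoc, ← hb.eq]
  rw [h1, h2, ← h] at hz
  exact mul_left_cancel (a := a * b * a * z) (by rw [hz, mul_one])

/-- The two relations give b⁻¹ab = aba⁻¹ = ba⁻¹b⁻¹, so b² conjugates a⁻¹ to a. Since b is conjugate
to a, b³ = 1 and b² = b⁻¹; hence b inverts a, and aba⁻¹ = a. -/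
theorem eq_of_braid_inv_of_pow_three {G : Type*} [Group G] {a b : G} (h3 : a ^ 3 = 1)
    (bab : a * b * a = b * a * b) (bbc : b * a⁻¹ * b = a⁻¹ * b * a⁻¹) : b = a := by
  have e1 : b⁻¹ * a * b = a * b * a⁻¹ := (conj_eq_inv_conj_of_braid bab.symm).symm
  have e2 : b * a⁻¹ * b⁻¹ = a * b * a⁻¹ := by
    simpa using conj_eq_inv_conj_of_braid bbc.symm
  have e3 : b * b * a⁻¹ * (b * b)⁻¹ = a := by
    calc b * b * a⁻¹ * (b * b)⁻¹ = b * (b * a⁻¹ * b⁻¹) * b⁻¹ := by group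
      _ = a := by rw [e2, ← e1]; group
  have hb3 : b ^ 3 = 1 := by
    rw [← conj_mul_eq_of_braid bab, conj_pow, h3]; group
  have hbb : b * b = b⁻¹ := by
    rw [eq_inv_iff_mul_eq_one, ← hb3, pow_succ, pow_two]
  rw [hbb, inv_inv] at e3
  have e4 : b⁻¹ * a * b = a⁻¹ := by
    have := congrArg (·⁻¹) e3
    simpa [mul_assoc] using this
  have e5 : b * a⁻¹ * b⁻¹ = a := by rw [← e4]; group
  rw [e1, ← e2, e5] at e4
  have : a * b * a⁻¹ = a := by rw [← e2, e5]
  calc b = a⁻¹ * (a * b * a⁻¹) * a := by group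
    _ = a := by rw [this]; group

namespace IsArtin

variable {G : Type*} [Group G] {N : ℕ} {t : ℕ → G}

theorem isConj_zero (h : IsArtin N t) (i : ℕ) (hi : i < N) : IsConj (t 0) (t i) := by
  induction i with
  | zero => exact IsConj.refl _
  | succ i ih =>
    exact (ih (by omega)).trans (isConj_iff.2 ⟨_, conj_mul_eq_of_braid (h.braid i hi)⟩)

theorem isConj_arc (h : IsArtin N t) (i k : ℕ) (hk : i + k < N) :
    IsConj (t 0) (arc t i k) := by
  induction k with
  | zero => exact h.isConj_zero i hk
  | succ k ih => exact (ih (by omega)).trans (isConj_iff.2 ⟨_, rfl⟩)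

theorem mul_card_centralizer_le [Finite G] (h : IsArtin N t) (ht : Set.InjOn t (Set.Iio N))
    (hN : N ≠ 3) (hN' : 2 ≤ N) :
    (N + 1) * N * Nat.card (Subgroup.centralizer {t 0}) ≤ 2 * Nat.card G := by
  classical
  -- Pairs of points with the larger one first.
  let P : Finset (Σ _ : ℕ, ℕ) := (Finset.range (N + 1)).sigma fun j => Finset.range j
  have hP : P.card * 2 = (N + 1) * N := by
    simp only [P, Finset.card_sigma, Finset.card_range]
    exact Finset.sum_range_id_mul_two (N + 1)
  have hmem : ∀ p ∈ P, p.1 < N + 1 ∧ p.2 < p.1 := fun p hp => by simpa [P] using hp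
  have hinj : Set.InjOn (fun p : Σ _ : ℕ, ℕ => arc t p.2 (p.1 - p.2 - 1)) P := by
    rintro ⟨j, i⟩ hp ⟨j', i'⟩ hp' he
    have h1 := hmem _ hp
    have h2 := hmem _ hp'
    simp only at h1 h2 he
    obtain ⟨rfl, h3⟩ := h.arc_injective ht hN hN' (by omega) (by omega) he
    obtain rfl : j = j' := by omega
    rfl
  have key := card_mul_card_centralizer_le (t 0)
    (P.image fun p : Σ _ : ℕ, ℕ => arc t p.2 (p.1 - p.2 - 1)) (by
      intro s hs
      obtain ⟨p, hp, rfl⟩ := Finset.mem_image.1 hs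
      have := hmem p hp
      exact h.isConj_arc _ _ (by omega))
  rw [Finset.card_image_of_injOn hinj] at key
  rw [← hP]
  nlinarith

/-- Compare `t i` and `t j` with each other if they are neighbours, otherwise with a neighbour `t k`
of `t i`. Either two braid relations differ by the central factor, which must then be trivial, or `t
k` commutes with `t j` and hence with `t i`. -/
theorem eq_of_eq_mul_central (h : IsArtin N t) (ht : Set.InjOn t (Set.Iio N)) (hN : 2 ≤ N)
    {z : G} (hz : ∀ m < N, Commute z (t m)) {i j : ℕ} (hi : i < N) (hj : j < N)
    (hij : t i = t j * z) : i = j := by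
  by_contra hne
  have hz1 : z ≠ 1 := fun hz1 => hne (ht hi hj (by rw [hij, hz1, mul_one]))
  have braid' : ∀ a b, a < N → b < N → (a + 1 = b ∨ b + 1 = a) →
      t a * t b * t a = t b * t a * t b := by
    rintro a b ha hb (rfl | rfl)
    · exact h.braid a hb
    · exact (h.braid b ha).symm
  have noncomm : ∀ a b, a < N → b < N → (a + 1 = b ∨ b + 1 = a) → ¬ Commute (t a) (t b) := by
    rintro a b ha hb (rfl | rfl)
    · exact h.not_commute_succ ht hb
    · exact fun hc => h.not_commute_succ ht ha hc.symm
  by_cases hadj : i + 1 = j ∨ j + 1 = i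
  · refine hz1 (eq_one_of_braid_mul_central (hz j hj) (hz j hj) rfl ?_)
    rw [← hij]
    exact braid' i j hi hj hadj
  · obtain ⟨k, hk, hik⟩ : ∃ k < N, i + 1 = k ∨ k + 1 = i := by
      by_cases h0 : i + 1 < N
      · exact ⟨i + 1, h0, .inl rfl⟩
      · exact ⟨i - 1, by omega, .inr (by omega)⟩
    by_cases hjk : j + 1 = k ∨ k + 1 = j
    · refine hz1 (eq_one_of_braid_mul_central (hz j hj) (hz k hk) (braid' j k hj hk hjk) ?_)
      rw [← hij]
      exact braid' i k hi hk hik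
    · refine noncomm i k hi hk hik ?_
      rw [hij]
      exact (h.commute_of_ne hj hk (by omega) (by omega)).mul_left (hz k hk)

/-- The centralizer of `t 0`, divided by the powers of `t 0`, inherits the generators from `t 2`
on, and these remain distinct. -/
theorem mul_orderOf_le_card_centralizer {G : Type u} [Group G] {t : ℕ → G} [Finite G] (h : IsArtin N t)
    (ht : Set.InjOn t (Set.Iio N)) (hN : 4 ≤ N) (B : ℕ)
    (hB : ∀ (Q : Type u) [Group Q] [Finite Q] (s : ℕ → Q), IsArtin (N - 2) s →
      Set.InjOn s (Set.Iio (N - 2)) → B ≤ Nat.card Q) :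
    B * orderOf (t 0) ≤ Nat.card (Subgroup.centralizer {t 0}) := by
  classical
  let C := Subgroup.centralizer {t 0}
  have hC : ∀ i, i + 2 < N → t (i + 2) ∈ C := fun i hi =>
    Subgroup.mem_centralizer_singleton_iff.2 (h.comm 0 (i + 2) (by omega) hi).symm.eq
  let c : C := ⟨t 0, Subgroup.mem_centralizer_singleton_iff.2 rfl⟩
  have hcen : ∀ x : C, Commute c x := fun x =>
    Subtype.ext (Subgroup.mem_centralizer_singleton_iff.1 x.2).symm
  have hnormal : (Subgroup.zpowers c).Normal := ⟨by
    rintro _ ⟨m, rfl⟩ x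
    exact ⟨m, by simp only [← ((hcen x).zpow_left m).eq, mul_inv_cancel_right]⟩⟩
  let s : ℕ → C := fun i => if hi : i + 2 < N then ⟨t (i + 2), hC i hi⟩ else 1
  have hs : ∀ i, i + 2 < N → (s i : G) = t (i + 2) := fun i hi => by simp [s, hi]
  have hsA : IsArtin (N - 2) s := by
    refine ⟨fun i hi => Subtype.ext ?_, fun i j hij hj => Subtype.ext ?_⟩
    · simp only [Subgroup.coe_mul, hs i (by omega), hs (i + 1) (by omega)]
      exact (h.shift 2).braid i hi
    · simp only [Subgroup.coe_mul, hs i (by omega), hs j (by omega)]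
      exact (h.shift 2).comm i j hij hj
  have hsi : Set.InjOn s (Set.Iio (N - 2)) := fun i hi j hj hij => by
    simp only [Set.mem_Iio] at hi hj
    have := congrArg (Subtype.val) hij
    rw [hs i (by omega), hs j (by omega)] at this
    have := ht (show i + 2 ∈ Set.Iio N by simp; omega) (show j + 2 ∈ Set.Iio N by simp; omega) this
    omega
  have hQ := hB (C ⧸ Subgroup.zpowers c) _ (hsA.map (QuotientGroup.mk' (Subgroup.zpowers c)))
    (fun i hi j hj hij => by
      obtain ⟨m, hm⟩ := QuotientGroup.eq.1 hij.symm
      exact hsA.eq_of_eq_mul_central hsi (by omega) (z := c ^ m)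
        (fun k _ => (hcen _).zpow_left m) hi hj (by simp only at hm; rw [hm, mul_inv_cancel_left]))
  have hcard := Subgroup.card_eq_card_quotient_mul_card_subgroup (Subgroup.zpowers c)
  rw [Nat.card_zpowers] at hcard
  have hord : orderOf c = orderOf (t 0) := (Subgroup.orderOf_coe c).symm
  rw [hord] at hcard
  change _ ≤ Nat.card C
  rw [hcard]
  exact Nat.mul_le_mul_right _ hQ

theorem two_le_orderOf [Finite G] (h : IsArtin N t) (ht : Set.InjOn t (Set.Iio N))
    (hN : 2 ≤ N) : 2 ≤ orderOf (t 0) := by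
  have h0 : 0 < orderOf (t 0) := orderOf_pos _
  have h1 : orderOf (t 0) ≠ 1 := fun h1 => by
    rw [orderOf_eq_one_iff] at h1
    refine h.not_commute_succ ht (i := 0) (by omega) ?_
    rw [h1]
    exact Commute.one_left _
  omega

/-- Complementary pairs have the same commutation pattern here, so the general count fails.
Commutation with `a` and `b` still separates {a, c}, {b, e} and {d, g}, leaving one inequality to
check in each. -/
theorem six_mul_card_centralizer_le [Finite G] (h : IsArtin 3 t) (ht : Set.InjOn t (Set.Iio 3)) :
    6 * Nat.card (Subgroup.centralizer {t 0}) ≤ Nat.card G := by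
  classical
  have hac : t 0 ≠ t 2 := fun e => by
    have := ht (show 0 ∈ Set.Iio 3 by simp) (show 2 ∈ Set.Iio 3 by simp) e
    omega
  have cab : ¬ Commute (t 0) (t 1) := h.not_commute_succ ht (by omega)
  have cbc : ¬ Commute (t 1) (t 2) := h.not_commute_succ ht (by omega)
  have cac : Commute (t 0) (t 2) := h.comm 0 2 (by omega) (by omega)
  have bab : t 0 * t 1 * t 0 = t 1 * t 0 * t 1 := h.braid 0 (by omega)
  have bbc : t 1 * t 2 * t 1 = t 2 * t 1 * t 2 := h.braid 1 (by omega)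
  have pa : IsConj (t 0) (t 0) := IsConj.refl _
  have pb : IsConj (t 0) (t 1) := h.isConj_zero 1 (by omega)
  have pc : IsConj (t 0) (t 2) := h.isConj_zero 2 (by omega)
  generalize t 0 = a at *
  generalize t 1 = b at *
  generalize t 2 = c at *
  have conj : ∀ x y : G, IsConj a x → IsConj a (y * x * y⁻¹) := fun x y hx =>
    hx.trans (isConj_iff.2 ⟨y, rfl⟩)
  have conj' : ∀ x y : G, IsConj a x → IsConj a (y⁻¹ * x * y) := fun x y hx => by
    simpa using conj x y⁻¹ hx
  have comm_conj' : ∀ {u v x : G}, Commute u v → (Commute u (v⁻¹ * x * v) ↔ Commute u x) := by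
    intro u v x huv
    simpa using commute_conj_of_commute (x := x) huv.inv_right
  -- `d`, `d'`, `g` have the points `{0,2}`, `{0,2}`, `{1,3}`, and `e` has `{0,3}`.
  have hd : b * a * b⁻¹ = a⁻¹ * b * a := conj_eq_inv_conj_of_braid bab
  have hd' : b⁻¹ * a * b = a * b * a⁻¹ := (conj_eq_inv_conj_of_braid bab.symm).symm
  have hg : c * b * c⁻¹ = b⁻¹ * c * b := conj_eq_inv_conj_of_braid bbc
  have ad : ¬ Commute a (b * a * b⁻¹) := by rwa [hd, comm_conj' (Commute.refl a)]
  have bd : ¬ Commute b (b * a * b⁻¹) := by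
    rw [commute_conj_of_commute (Commute.refl b)]; exact fun hc => cab hc.symm
  have ad' : ¬ Commute a (b⁻¹ * a * b) := by rwa [hd', commute_conj_of_commute (Commute.refl a)]
  have bd' : ¬ Commute b (b⁻¹ * a * b) := by
    rw [comm_conj' (Commute.refl b)]; exact fun hc => cab hc.symm
  have ag : ¬ Commute a (c * b * c⁻¹) := by rwa [commute_conj_of_commute cac]
  have bg : ¬ Commute b (c * b * c⁻¹) := by rwa [hg, comm_conj' (Commute.refl b)]
  have ae : ¬ Commute a (c * (b * a * b⁻¹) * c⁻¹) := by rwa [commute_conj_of_commute cac]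
  have be : Commute b (c * (b * a * b⁻¹) * c⁻¹) := by
    -- Conjugation by `c * b` sends the commuting pair `c`, `a` to `b` and the arc `e`.
    have := (Commute.conj_iff (c * b)).2 cac.symm
    rw [conj_mul_eq_of_braid bbc.symm] at this
    simpa only [mul_assoc, mul_inv_rev] using this
  have hbe : b ≠ c * (b * a * b⁻¹) * c⁻¹ := fun e => by
    have h1 : c⁻¹ * b * c = b * a * b⁻¹ := by
      calc c⁻¹ * b * c = c⁻¹ * (c * (b * a * b⁻¹) * c⁻¹) * c := by rw [← e]
        _ = _ := by group
    rw [← conj_eq_inv_conj_of_braid bbc.symm] at h1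
    exact hac (mul_left_cancel (mul_right_cancel h1)).symm
  have pe := conj _ c (conj _ b pa)
  have pd := conj _ b pa
  have pd' := conj' _ b pa
  have pg := conj _ c pb
  -- The sixth conjugate is whichever candidate differs from `d`; if both equalled `d`, then `a =
  -- c`.
  have hdg : b * a * b⁻¹ ≠ b⁻¹ * a * b ∨ b * a * b⁻¹ ≠ c * b * c⁻¹ := by
    by_contra! hh
    rw [hh.2, hg] at hh
    exact hac (mul_left_cancel (mul_right_cancel hh.1)).symm
  obtain ⟨g, hdg, ag, bg, pg⟩ : ∃ g, b * a * b⁻¹ ≠ g ∧ ¬ Commute a g ∧ ¬ Commute b g ∧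
      IsConj a g := by
    rcases hdg with hdg | hdg
    · exact ⟨_, hdg, ad', bd', pd'⟩
    · exact ⟨_, hdg, ag, bg, pg⟩
  generalize c * (b * a * b⁻¹) * c⁻¹ = e at *
  generalize b * a * b⁻¹ = d at *
  have ne : ∀ {u x y : G}, Commute u x → ¬ Commute u y → x ≠ y := by
    rintro u x y hx hy rfl; exact hy hx
  have aa := Commute.refl a
  have bb := Commute.refl b
  have hcard : ({a, b, c, d, e, g} : Finset G).card = 6 := by
    have := ne aa cab
    have := ne aa ad
    have := ne aa ae
    have := ne aa ag
    have := ne cac cab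
    have := ne cac ad
    have := ne cac ae
    have := ne cac ag
    have := ne bb bd
    have := ne bb bg
    have := ne be bd
    have := ne be bg
    have : c ≠ b := by assumption
    rw [Finset.card_insert_of_notMem, Finset.card_insert_of_notMem, Finset.card_insert_of_notMem,
      Finset.card_insert_of_notMem, Finset.card_insert_of_notMem, Finset.card_singleton]
    all_goals
      simp only [Finset.mem_insert, Finset.mem_singleton, not_or]
      grind
  rw [← hcard]
  refine card_mul_card_centralizer_le a _ fun s hs => ?_
  simp only [Finset.mem_insert, Finset.mem_singleton] at hs
  rcases hs with rfl | rfl | rfl | rfl | rfl | rfl <;> assumption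

/-- If the powers of `t 0` have index at least two in the centralizer, their number is at least two
and the bound follows. Otherwise `t 2` is itself a power of `t 0`; in order below four this leaves
only order three and `t 2 = (t 0)⁻¹`, which the braid relations exclude. -/
theorem four_le_card_centralizer [Finite G] (h : IsArtin 3 t) (ht : Set.InjOn t (Set.Iio 3)) :
    4 ≤ Nat.card (Subgroup.centralizer {t 0}) := by
  have hac : t 0 ≠ t 2 := fun e => by
    have := ht (show 0 ∈ Set.Iio 3 by simp) (show 2 ∈ Set.Iio 3 by simp) e
    omega
  have cac : Commute (t 0) (t 2) := h.comm 0 2 (by omega) (by omega)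
  have bab : t 0 * t 1 * t 0 = t 1 * t 0 * t 1 := h.braid 0 (by omega)
  have bbc : t 1 * t 2 * t 1 = t 2 * t 1 * t 2 := h.braid 1 (by omega)
  have h2 := h.two_le_orderOf ht (by omega)
  have hc2 : t 2 ≠ 1 := fun e => h.not_commute_succ ht (i := 1) (by omega) (by
    simp only [e]; exact Commute.one_right _)
  have hle : Subgroup.zpowers (t 0) ≤ Subgroup.centralizer {t 0} := by
    rw [Subgroup.zpowers_le]; exact Subgroup.mem_centralizer_singleton_iff.2 rfl
  obtain ⟨m, hm⟩ := Subgroup.card_dvd_of_le hle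
  rw [Nat.card_zpowers] at hm
  have hm0 : 0 < m := by
    rcases Nat.eq_zero_or_pos m with rfl | h0
    · have : 0 < Nat.card (Subgroup.centralizer {t 0}) := Nat.card_pos
      omega
    · exact h0
  rw [hm]
  rcases Nat.lt_or_ge 1 m with hm1 | hm1
  · nlinarith
  obtain rfl : m = 1 := by omega
  rw [mul_one] at hm ⊢
  by_contra hlt
  have heq : Subgroup.zpowers (t 0) = Subgroup.centralizer {t 0} :=
    Subgroup.eq_of_le_of_card_ge hle (by rw [hm, Nat.card_zpowers])
  have hmem : t 2 ∈ Subgroup.zpowers (t 0) := by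
    rw [heq]; exact Subgroup.mem_centralizer_singleton_iff.2 cac.symm.eq
  classical
  rw [mem_zpowers_iff_mem_range_orderOf] at hmem
  obtain ⟨k, hk, hk'⟩ := Finset.mem_image.1 hmem
  have hk := Finset.mem_range.1 hk
  have hk0 : k ≠ 0 := by rintro rfl; exact hc2 (by simpa using hk'.symm)
  have hk1 : k ≠ 1 := by rintro rfl; exact hac (by simpa using hk')
  obtain rfl : k = 2 := by omega
  have hord : orderOf (t 0) = 3 := by omega
  have cab : ¬ Commute (t 0) (t 1) := h.not_commute_succ ht (by omega)
  have h3 : t 0 ^ 3 = 1 := hord ▸ pow_orderOf_eq_one (t 0)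
  have hinv : t 2 = (t 0)⁻¹ := by
    rw [← hk', eq_inv_iff_mul_eq_one, ← pow_succ, h3]
  rw [hinv] at bbc
  refine cab ?_
  rw [eq_of_braid_inv_of_pow_three h3 bab bbc]

/-- The factor `orderOf (t 0)` is kept because it detects equality; the induction removes two
generators and uses only the second bound, which also covers N = 3. -/
theorem factorial_mul_orderOf_le_card : ∀ (N : ℕ) (G : Type u) [Group G] [Finite G] (t : ℕ → G),
    IsArtin N t → Set.InjOn t (Set.Iio N) → 2 ≤ N →
      (N ≠ 3 → Nat.factorial (N + 1) * orderOf (t 0) ≤ 2 * Nat.card G) ∧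
        Nat.factorial (N + 1) ≤ Nat.card G := by
  intro N
  induction N using Nat.strong_induction_on with
  | _ N ih =>
  intro G _ _ t h ht hN
  have h2 := h.two_le_orderOf ht hN
  by_cases h3 : N = 3
  · subst h3
    refine ⟨fun hne => absurd rfl hne, ?_⟩
    have := h.six_mul_card_centralizer_le ht
    have := h.four_le_card_centralizer ht
    simp only [Nat.factorial]
    omega
  have key := h.mul_card_centralizer_le ht h3 hN
  have hC : Nat.factorial (N - 1) * orderOf (t 0) ≤ Nat.card (Subgroup.centralizer {t 0}) := by
    by_cases hN4 : 4 ≤ N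
    · refine h.mul_orderOf_le_card_centralizer ht hN4 _ fun Q _ _ s hs hsi => ?_
      have := (ih (N - 2) (by omega) Q s hs hsi (by omega)).2
      rwa [show N - 2 + 1 = N - 1 by omega] at this
    · obtain rfl : N = 2 := by omega
      have hle : Subgroup.zpowers (t 0) ≤ Subgroup.centralizer {t 0} := by
        rw [Subgroup.zpowers_le]; exact Subgroup.mem_centralizer_singleton_iff.2 rfl
      have := Subgroup.card_le_of_le hle
      rwa [Nat.card_zpowers, ← one_mul (orderOf (t 0))] at this
  have hfac : Nat.factorial (N + 1) = (N + 1) * N * Nat.factorial (N - 1) := by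
    obtain ⟨M, rfl⟩ : ∃ M, N = M + 1 := ⟨N - 1, by omega⟩
    simp [Nat.factorial_succ, mul_assoc]
  have main : Nat.factorial (N + 1) * orderOf (t 0) ≤ 2 * Nat.card G := by
    rw [hfac, mul_assoc]
    exact (Nat.mul_le_mul_left _ hC).trans key
  exact ⟨fun _ => main, by nlinarith⟩

end IsArtin

/-! ### Upper bound for involutions, and coincidences among generators -/

namespace IsArtin

variable {G : Type*} [Group G] {N : ℕ} {t : ℕ → G}

/-- The product `t 0 * t 1 * ⋯ * t (j - 1)`. -/
def initProd (t : ℕ → G) : ℕ → G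
  | 0 => 1
  | j + 1 => initProd t j * t j

theorem initProd_mul_of_lt (h : IsArtin N t) {i : ℕ} (hi : i < N) (j : ℕ) (hj : j < i) :
    initProd t j * t i = t i * initProd t j := by
  induction j with
  | zero => simp [initProd]
  | succ j ih =>
    rw [initProd, mul_assoc, (h.comm j i (by omega) hi).eq, ← mul_assoc, ih (by omega), mul_assoc]

theorem initProd_mul_of_gt (h : IsArtin N t) {i : ℕ} (j : ℕ) (hij : i + 1 < j) (hj : j ≤ N) :
    initProd t j * t i = t (i + 1) * initProd t j := by
  induction j with
  | zero => omega
  | succ j ih =>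
    by_cases hlt : i + 1 < j
    · rw [initProd, mul_assoc, ← (h.comm i j hlt (by omega)).eq, ← mul_assoc, ih hlt (by omega),
        mul_assoc]
    · obtain rfl : j = i + 1 := by omega
      rw [initProd, initProd]
      calc initProd t i * t i * t (i + 1) * t i
          = initProd t i * (t i * t (i + 1) * t i) := by group
        _ = initProd t i * t (i + 1) * (t i * t (i + 1)) := by rw [h.braid i (by omega)]; group
        _ = _ := by rw [h.initProd_mul_of_lt (by omega) i (by omega)]; group

/-- A group generated by `N` involutions satisfying the Artin relations has order at most
`(N + 1)!`. -/
theorem card_closure_le (N : ℕ) : ∀ t : ℕ → G, IsArtin N t → (∀ i < N, t i * t i = 1) →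
    Finite (Subgroup.closure (t '' Set.Iio N)) ∧
      Nat.card (Subgroup.closure (t '' Set.Iio N)) ≤ Nat.factorial (N + 1) := by
  induction N with
  | zero =>
    intro t _ _
    have : t '' Set.Iio 0 = ∅ := by simp
    rw [this, Subgroup.closure_empty]
    exact ⟨inferInstance, by simp⟩
  | succ N ih =>
    intro t h ht
    let H := Subgroup.closure ((fun i => t (i + 1)) '' Set.Iio N)
    obtain ⟨hfin, hcard⟩ := ih (fun i => t (i + 1)) (h.shift 1) fun i hi => ht _ (by omega)
    have hH : ∀ i, i < N → t (i + 1) ∈ H := fun i hi =>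
      Subgroup.subset_closure ⟨i, hi, rfl⟩
    -- The `N + 2` products `initProd t j` represent the right cosets of `H`; right multiplication
    -- by a generator permutes these cosets.
    let φ : Fin (N + 2) × H → G := fun p => p.2 * initProd t p.1
    have step : ∀ x ∈ Set.range φ, ∀ i < N + 1, x * t i ∈ Set.range φ := by
      rintro _ ⟨⟨⟨j, hj⟩, y⟩, rfl⟩ i hi
      simp only [φ, mul_assoc]
      rcases lt_trichotomy j i with hji | rfl | hij
      · rw [h.initProd_mul_of_lt hi j hji]
        refine ⟨⟨⟨j, hj⟩, y * ⟨t i, ?_⟩⟩, by simp [mul_assoc]⟩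
        have := hH (i - 1) (by omega)
        rwa [show i - 1 + 1 = i by omega] at this
      · exact ⟨⟨⟨j + 1, by omega⟩, y⟩, rfl⟩
      · by_cases hlt : i + 1 < j
        · rw [h.initProd_mul_of_gt j hlt (by omega)]
          exact ⟨⟨⟨j, hj⟩, y * ⟨t (i + 1), hH i (by omega)⟩⟩, by simp [mul_assoc]⟩
        · obtain rfl : j = i + 1 := by omega
          rw [initProd, mul_assoc, ht i hi, mul_one]
          exact ⟨⟨⟨i, by omega⟩, y⟩, rfl⟩
    have hsub : (Subgroup.closure (t '' Set.Iio (N + 1)) : Set G) ⊆ Set.range φ := by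
      intro x hx
      induction hx using Subgroup.closure_induction_right with
      | one => exact ⟨⟨⟨0, by omega⟩, 1⟩, by simp [φ, initProd]⟩
      | mul_right x _ y hy hx =>
        obtain ⟨i, hi, rfl⟩ := hy
        exact step x hx i hi
      | mul_inv_cancel x _ y hy hx =>
        obtain ⟨i, hi, rfl⟩ := hy
        rw [inv_eq_of_mul_eq_one_right (ht i hi)]
        exact step x hx i hi
    refine ⟨(Set.finite_range φ).subset hsub, (Nat.card_mono (Set.finite_range φ) hsub).trans
      ((Finite.card_range_le φ).trans ?_)⟩
    rw [Nat.card_prod, Nat.card_fin, Nat.factorial_succ (N + 1)]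
    exact Nat.mul_le_mul_left _ hcard

/-- A coincidence spreads both ways: the next generator commutes with one of the two equal ones,
hence with its own neighbour. -/
theorem eq_succ_of_eq_succ (h : IsArtin N t) {k : ℕ} (hk : k + 1 < N) (e : t k = t (k + 1)) :
    ∀ i, i + 1 < N → t i = t (i + 1) := by
  have up : ∀ i, k ≤ i → i + 1 < N → t i = t (i + 1) := by
    intro i hki
    induction i, hki using Nat.le_induction with
    | base => exact fun _ => e
    | succ i _ ih =>
      intro hi
      refine eq_of_braid_of_commute (h.braid _ hi) ?_
      rw [← ih (by omega)]
      exact h.comm _ _ (by omega) hi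
  have down : ∀ d i, i + d = k → t i = t (i + 1) := by
    intro d
    induction d with
    | zero => rintro i rfl; exact e
    | succ d ih =>
      intro i hi
      refine eq_of_braid_of_commute (h.braid _ (by omega)) ?_
      rw [ih (i + 1) (by omega)]
      exact h.comm _ _ (by omega) (by omega)
  intro i hi
  rcases le_total k i with hki | hki
  · exact up i hki hi
  · exact down (k - i) i (by omega)

theorem eq_zero_of_eq_succ (h : IsArtin N t) {k : ℕ} (hk : k + 1 < N) (e : t k = t (k + 1)) :
    ∀ i < N, t i = t 0 := by
  intro i
  induction i with
  | zero => exact fun _ => rfl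
  | succ i ih => exact fun hi => (h.eq_succ_of_eq_succ hk e i hi).symm.trans (ih (by omega))

/-- Artin generators with a coincidence all agree, but for `t 0 = t 2` when `N = 3`. -/
theorem eq_zero_of_not_injOn (h : IsArtin N t) (hN : N = 3 → t 0 ≠ t 2)
    (ht : ¬ Set.InjOn t (Set.Iio N)) : ∀ i < N, t i = t 0 := by
  have key : ∀ i j, i < j → j < N → t i = t j → ∀ m < N, t m = t 0 := by
    intro i j hij hj e
    by_cases h1 : i + 1 = j
    · subst h1
      exact h.eq_zero_of_eq_succ hj e
    · by_cases h2 : j + 1 < N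
      · refine h.eq_zero_of_eq_succ h2 (eq_of_braid_of_commute (h.braid j h2) ?_)
        rw [← e]
        exact h.comm _ _ (by omega) h2
      · rcases i with _ | i
        · have hj2 : j ≠ 2 := by rintro rfl; exact hN (by omega) e
          refine h.eq_zero_of_eq_succ (k := 0) (by omega)
            (eq_of_braid_of_commute (h.braid 0 (by omega)) ?_)
          rw [e]
          exact (h.comm 1 j (by omega) hj).symm
        · refine h.eq_zero_of_eq_succ (k := i) (by omega)
            (eq_of_braid_of_commute (h.braid i (by omega)) ?_)
          rw [e]
          exact h.comm _ _ (by omega) hj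
  simp only [Set.InjOn, Set.mem_Iio] at ht
  push Not at ht
  obtain ⟨i, hi, j, hj, e, hne⟩ := ht
  rcases lt_or_gt_of_ne hne with hlt | hlt
  · exact key i j hlt hj e
  · exact key j i hlt hi e.symm

end IsArtin

/-! ### From generating sequences to homomorphisms out of the braid group -/

namespace BraidGroup

variable {n : ℕ}

theorem σ_braid (i j : Fin (n - 1)) (h : (i : ℕ) + 1 = j) :
    (σ i * σ j * σ i : BraidGroup n) = σ j * σ i * σ j :=
  mul_inv_eq_one.1 (PresentedGroup.one_of_mem (rels := braidRelations n) (.inl ⟨i, j, h, rfl⟩))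

theorem σ_comm (i j : Fin (n - 1)) (h : (i : ℕ) + 1 < j) :
    (σ i * σ j : BraidGroup n) = σ j * σ i :=
  mul_inv_eq_one.1 (PresentedGroup.one_of_mem (rels := braidRelations n) (.inr ⟨i, j, h, rfl⟩))

theorem closure_range_σ : Subgroup.closure (Set.range (σ : Fin (n - 1) → BraidGroup n)) = ⊤ :=
  PresentedGroup.closure_range_of _

/-- The images of the half-twists, as a sequence continued by `1`. -/
def genSeq {G : Type*} [Group G] (f : BraidGroup n →* G) (i : ℕ) : G :=
  if hi : i < n - 1 then f (σ ⟨i, hi⟩) else 1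

theorem genSeq_of_lt {G : Type*} [Group G] (f : BraidGroup n →* G) {i : ℕ} (hi : i < n - 1) :
    genSeq f i = f (σ ⟨i, hi⟩) := dif_pos hi

theorem isArtin_genSeq {G : Type*} [Group G] (f : BraidGroup n →* G) :
    IsArtin (n - 1) (genSeq f) where
  braid i hi := by
    rw [genSeq_of_lt f hi, genSeq_of_lt f (show i < n - 1 by omega)]
    simp only [← map_mul]
    rw [σ_braid _ _ rfl]
  comm i j hij hj := by
    rw [genSeq_of_lt f hj, genSeq_of_lt f (show i < n - 1 by omega)]
    simp only [Commute, SemiconjBy, ← map_mul]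
    rw [σ_comm _ _ hij]

theorem range_eq_closure {G : Type*} [Group G] (f : BraidGroup n →* G) :
    f.range = Subgroup.closure (genSeq f '' Set.Iio (n - 1)) := by
  rw [MonoidHom.range_eq_map, ← closure_range_σ, MonoidHom.map_closure]
  congr 1
  ext x
  constructor
  · rintro ⟨_, ⟨i, rfl⟩, rfl⟩
    exact ⟨i, i.2, genSeq_of_lt f i.2⟩
  · rintro ⟨i, hi, rfl⟩
    exact ⟨_, ⟨⟨i, hi⟩, rfl⟩, (genSeq_of_lt f hi).symm⟩

theorem hom_ext {G : Type*} [Group G] {f g : BraidGroup n →* G} (h : ∀ i, f (σ i) = g (σ i)) :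
    f = g := PresentedGroup.ext h

theorem isCyclic_of_genSeq_eq {G : Type*} [Group G] {f : BraidGroup n →* G}
    (hf : Function.Surjective f) (h : ∀ i < n - 1, genSeq f i = genSeq f 0) : IsCyclic G := by
  have hle : f.range ≤ Subgroup.zpowers (genSeq f 0) := by
    rw [range_eq_closure, Subgroup.closure_le]
    rintro _ ⟨i, hi, rfl⟩
    rw [h i hi]
    exact Subgroup.mem_zpowers _
  rw [MonoidHom.range_eq_top.2 hf] at hle
  exact ⟨genSeq f 0, fun x => hle (Subgroup.mem_top x)⟩

theorem injOn_genSeq {G : Type*} [Group G] {f : BraidGroup n →* G} (hf : Function.Surjective f)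
    (hG : ¬ IsCyclic G) (h4 : n = 4 → genSeq f 0 ≠ genSeq f 2) :
    Set.InjOn (genSeq f) (Set.Iio (n - 1)) := by
  by_contra hinj
  exact hG (isCyclic_of_genSeq_eq hf
    ((isArtin_genSeq f).eq_zero_of_not_injOn (fun h => h4 (by omega)) hinj))

theorem factorial_le_card {G : Type*} [Group G] [Finite G] {f : BraidGroup n →* G}
    (hf : Function.Surjective f) (hG : ¬ IsCyclic G) (hn : 3 ≤ n)
    (h4 : n = 4 → genSeq f 0 ≠ genSeq f 2) : n.factorial ≤ Nat.card G := by
  have := ((isArtin_genSeq f).factorial_mul_orderOf_le_card _ _ _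
    (injOn_genSeq hf hG h4) (by omega)).2
  rwa [show n - 1 + 1 = n by omega] at this

/-- In the equality case n! · ord ≤ 2 · n! forces order two, and all generators are conjugate. -/
theorem genSeq_mul_self {G : Type*} [Group G] [Finite G] {f : BraidGroup n →* G}
    (hf : Function.Surjective f) (hG : ¬ IsCyclic G) (hn : 3 ≤ n) (h4 : n ≠ 4)
    (hcard : Nat.card G = n.factorial) : ∀ i < n - 1, genSeq f i * genSeq f i = 1 := by
  have hA := isArtin_genSeq f
  have hi := injOn_genSeq hf hG fun h => absurd h h4
  have h1 := (hA.factorial_mul_orderOf_le_card _ _ _ hi (by omega)).1 (by omega)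
  have h2 := hA.two_le_orderOf hi (by omega)
  rw [show n - 1 + 1 = n by omega, hcard, mul_comm] at h1
  have h3 : orderOf (genSeq f 0) = 2 :=
    le_antisymm (Nat.le_of_mul_le_mul_right h1 n.factorial_pos) h2
  intro i hin
  obtain ⟨c, hc⟩ := isConj_iff.1 (hA.isConj_zero i hin)
  rw [← pow_two, ← hc, conj_pow, ← h3, pow_orderOf_eq_one]
  group

/-- The image of `f.prod s` is generated by involutions satisfying the Artin relations, so it is no
larger than either factor. It is therefore the graph of an isomorphism. -/
theorem quotientEquivalent_of_card {G : Type u} [Group G] [Finite G] {S : Type} [Group S]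
    [Finite S] {f : BraidGroup n →* G} {s : BraidGroup n →* S} (hf : Function.Surjective f)
    (hs : Function.Surjective s) (hn : 1 ≤ n) (hf2 : ∀ i < n - 1, genSeq f i * genSeq f i = 1)
    (hs2 : ∀ i < n - 1, genSeq s i * genSeq s i = 1) (hG : Nat.card G = n.factorial)
    (hS : Nat.card S = n.factorial) : QuotientEquivalent f s := by
  let Γ := (f.prod s).range
  have hΓ : Nat.card Γ ≤ n.factorial := by
    have h := (IsArtin.card_closure_le (n - 1) _ (isArtin_genSeq (f.prod s)) fun i hi => by
      have h1 := hf2 i hi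
      have h2 := hs2 i hi
      rw [genSeq_of_lt _ hi] at h1 h2 ⊢
      exact Prod.ext h1 h2).2
    rwa [← range_eq_closure, show n - 1 + 1 = n by omega] at h
  let p : Γ →* G := (MonoidHom.fst G S).comp Γ.subtype
  let q : Γ →* S := (MonoidHom.snd G S).comp Γ.subtype
  have hp : Function.Bijective p := by
    refine Function.Surjective.bijective_of_nat_card_le (fun x => ?_) (by rwa [hG])
    obtain ⟨b, rfl⟩ := hf x
    exact ⟨⟨_, b, rfl⟩, rfl⟩
  have hq : Function.Bijective q := by
    refine Function.Surjective.bijective_of_nat_card_le (fun x => ?_) (by rwa [hS])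
    obtain ⟨b, rfl⟩ := hs x
    exact ⟨⟨_, b, rfl⟩, rfl⟩
  refine ⟨(MulEquiv.ofBijective p hp).symm.trans (MulEquiv.ofBijective q hq), fun b => ?_⟩
  have : f b = MulEquiv.ofBijective p hp ⟨(f.prod s) b, b, rfl⟩ := rfl
  rw [MulEquiv.trans_apply, this, MulEquiv.symm_apply_apply]
  rfl

theorem genSeq_toPerm {i : ℕ} (hi : i < n - 1) :
    genSeq (toPerm n) i = Equiv.swap ⟨i, by omega⟩ ⟨i + 1, by omega⟩ := by
  rw [genSeq_of_lt _ hi, toPerm, lift_σ]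
  rfl

theorem toPerm_surjective (n : ℕ) : Function.Surjective (toPerm n) := by
  rcases n with _ | n
  · exact fun x => ⟨1, Subsingleton.elim _ _⟩
  rw [← MonoidHom.range_eq_top, eq_top_iff, ← Subgroup.closure_eq_top_of_mclosure_eq_top
    (Equiv.Perm.mclosure_swap_castSucc_succ n), Subgroup.closure_le]
  rintro _ ⟨i, rfl⟩
  refine ⟨σ (n := n + 1) ⟨i, i.2⟩, ?_⟩
  rw [toPerm, lift_σ]
  rfl

theorem not_isCyclic_perm (hn : 3 ≤ n) : ¬ IsCyclic (Equiv.Perm (Fin n)) := by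
  rintro ⟨g, hg⟩
  obtain ⟨a, ha⟩ := hg (Equiv.swap ⟨0, by omega⟩ ⟨1, by omega⟩)
  obtain ⟨b, hb⟩ := hg (Equiv.swap ⟨1, by omega⟩ ⟨2, by omega⟩)
  have h := (Commute.refl g).zpow_zpow a b
  simp only at ha hb
  rw [ha, hb] at h
  have := congrArg (fun e : Equiv.Perm (Fin n) => (e ⟨0, by omega⟩ : ℕ)) h.eq
  simp [Equiv.Perm.mul_apply, Equiv.swap_apply_def] at this

theorem toPerm_isNoncyclicQuotient (hn : 3 ≤ n) : IsNoncyclicQuotient (toPerm n) :=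
  ⟨toPerm_surjective n, not_isCyclic_perm hn⟩

end BraidGroup

/-! ### Minimality in terms of finite orders -/

theorem isMinimalNoncyclicQuotient_of_card {B : Type} [Group B] {G : Type u} [Group G] [Finite G]
    {f : B →* G} (hf : IsNoncyclicQuotient f)
    (h : ∀ (H : Type) [Group H] [Finite H] (g : B →* H), IsNoncyclicQuotient g →
      Nat.card G ≤ Nat.card H) : IsMinimalNoncyclicQuotient f := by
  refine ⟨hf, ?_⟩
  rintro ⟨H, _, g, hg, hlt⟩
  have hG : Cardinal.lift.{0} (Cardinal.mk G) < Cardinal.aleph0 := by simp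
  have hH := hlt.trans hG
  rw [Cardinal.lift_lt_aleph0, Cardinal.lt_aleph0_iff_finite] at hH
  have := h H g hg
  rw [← Nat.cast_card (α := H), ← Nat.cast_card (α := G)] at hlt
  simp only [Cardinal.lift_natCast, Nat.cast_lt] at hlt
  omega

theorem IsMinimalNoncyclicQuotient.card_le {B : Type} [Group B] {G : Type u} [Group G] {f : B →* G}
    (hf : IsMinimalNoncyclicQuotient f) {H : Type} [Group H] [Finite H] {g : B →* H}
    (hg : IsNoncyclicQuotient g) : Finite G ∧ Nat.card G ≤ Nat.card H := by
  have hle := not_lt.1 fun hlt => hf.2 ⟨H, _, g, hg, hlt⟩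
  have hH : Cardinal.lift.{u} (Cardinal.mk H) < Cardinal.aleph0 := by simp
  have hG := hle.trans_lt hH
  rw [Cardinal.lift_lt_aleph0, Cardinal.lt_aleph0_iff_finite] at hG
  refine ⟨hG, ?_⟩
  rw [← Nat.cast_card (α := H), ← Nat.cast_card (α := G)] at hle
  simpa only [Cardinal.lift_natCast, Nat.cast_le] using hle

/-! ### Recognizing transpositions by their centralizers -/

open Equiv in
theorem nat_card_centralizer_of_cycleType_replicate {α : Type*} [Fintype α] [DecidableEq α]
    {e : Perm α} {k : ℕ} (hk : e.cycleType = Multiset.replicate k 2) :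
    Nat.card (Subgroup.centralizer {e}) =
      Nat.factorial (Fintype.card α - 2 * k) * 2 ^ k * Nat.factorial k := by
  rw [Perm.nat_card_centralizer, hk, Multiset.sum_replicate, Multiset.prod_replicate, smul_eq_mul,
    mul_comm k 2]
  congr 1
  rcases Nat.eq_zero_or_pos k with rfl | hpos
  · simp
  · rw [Multiset.toFinset_replicate, if_neg hpos.ne', Finset.prod_singleton,
      Multiset.count_replicate_self]

/-- With k + 4 replaced by k, this is 2^k · k! < 2 · (2k − 2)! for k ≥ 4, which rules out products
of four or more disjoint transpositions. -/
theorem two_pow_mul_factorial_lt (k : ℕ) :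
    2 ^ (k + 4) * Nat.factorial (k + 4) < 2 * Nat.factorial (2 * k + 6) := by
  induction k with
  | zero => decide
  | succ k ih =>
    have h1 : Nat.factorial (2 * (k + 1) + 6) =
        (2 * k + 8) * ((2 * k + 7) * Nat.factorial (2 * k + 6)) := by
      rw [show 2 * (k + 1) + 6 = 2 * k + 6 + 1 + 1 by ring, Nat.factorial_succ, Nat.factorial_succ]
    have h2 : Nat.factorial (k + 1 + 4) = (k + 5) * Nat.factorial (k + 4) := by
      rw [show k + 1 + 4 = k + 4 + 1 by ring, Nat.factorial_succ]
    rw [h1, h2, show k + 1 + 4 = k + 4 + 1 by ring, pow_succ]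
    calc 2 ^ (k + 4) * 2 * ((k + 5) * Nat.factorial (k + 4))
        = (2 * (k + 5)) * (2 ^ (k + 4) * Nat.factorial (k + 4)) := by ring
      _ < (2 * (k + 5)) * (2 * Nat.factorial (2 * k + 6)) :=
          Nat.mul_lt_mul_of_pos_left ih (by omega)
      _ ≤ ((2 * k + 8) * (2 * k + 7)) * (2 * Nat.factorial (2 * k + 6)) :=
          Nat.mul_le_mul_right _ (by nlinarith)
      _ = _ := by ring

/-- Outside degree six, no class of involutions other than the transpositions has the size of the
class of transpositions. -/
theorem eq_one_of_centralizer_card {n k : ℕ} (hn6 : n ≠ 6) (hk : k ≠ 0) (hkn : 2 * k ≤ n)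
    (h : Nat.factorial (n - 2 * k) * 2 ^ k * Nat.factorial k = Nat.factorial (n - 2) * 2) :
    k = 1 := by
  obtain ⟨m, rfl⟩ : ∃ m, n = m + 2 * k := ⟨n - 2 * k, by omega⟩
  rw [Nat.add_sub_cancel] at h
  have hm := m.factorial_pos
  by_contra hk1
  obtain rfl | rfl | ⟨l, rfl⟩ : k = 2 ∨ k = 3 ∨ ∃ l, k = l + 4 := by
    rcases k with _ | _ | _ | _ | k
    · omega
    · omega
    · simp
    · simp
    · exact .inr (.inr ⟨k, rfl⟩)
  · rw [show m + 2 * 2 - 2 = m + 1 + 1 by omega, Nat.factorial_succ, Nat.factorial_succ] at h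
    have h2 : Nat.factorial m * 4 = Nat.factorial m * ((m + 1 + 1) * (m + 1)) := by
      simp only [Nat.factorial] at h ⊢
      nlinarith
    have h3 := Nat.eq_of_mul_eq_mul_left hm h2
    rcases m with _ | m
    · omega
    · nlinarith
  · rw [show m + 2 * 3 - 2 = m + 1 + 1 + 1 + 1 by omega] at h
    simp only [Nat.factorial_succ (m + 1 + 1 + 1), Nat.factorial_succ (m + 1 + 1),
      Nat.factorial_succ (m + 1), Nat.factorial_succ m] at h
    have h2 : Nat.factorial m * 24 =
        Nat.factorial m * ((m + 1 + 1 + 1 + 1) * ((m + 1 + 1 + 1) * ((m + 1 + 1) * (m + 1)))) := by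
      have h6 : Nat.factorial 3 = 6 := rfl
      rw [h6] at h
      linarith
    have h3 := Nat.eq_of_mul_eq_mul_left hm h2
    -- The equation 24 = (m + 4)(m + 3)(m + 2)(m + 1) has the solution m = 0, which is n = 6.
    rcases m with _ | m
    · omega
    · have : 4 * (3 * (2 * (m + 1 + 1))) ≤
          (m + 1 + 1 + 1 + 1 + 1) * ((m + 1 + 1 + 1 + 1) * ((m + 1 + 1 + 1) * (m + 1 + 1))) := by
        gcongr <;> omega
      omega
  · have h1 := two_pow_mul_factorial_lt l
    have h2 := Nat.le_of_dvd (Nat.factorial_pos _)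
      (Nat.factorial_mul_factorial_dvd_factorial_add m (2 * l + 6))
    rw [show m + 2 * (l + 4) - 2 = m + (2 * l + 6) by omega] at h
    have h3 := Nat.mul_lt_mul_of_pos_left h1 hm
    nlinarith

theorem MulEquiv.nat_card_centralizer {G H : Type*} [Group G] [Group H] (φ : G ≃* H) (x : G) :
    Nat.card (Subgroup.centralizer {x}) = Nat.card (Subgroup.centralizer {φ x}) :=
  Nat.card_congr (φ.toEquiv.subtypeEquiv fun a => by
    rw [Subgroup.mem_centralizer_singleton_iff, Subgroup.mem_centralizer_singleton_iff]
    simp only [MulEquiv.toEquiv_eq_coe, EquivLike.coe_coe, ← map_mul, φ.injective.eq_iff])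

namespace Equiv.Perm

theorem isSwap_of_mulEquiv {n : ℕ} (hn6 : n ≠ 6) (φ : Perm (Fin n) ≃* Perm (Fin n))
    {e : Perm (Fin n)} (he : (φ e).IsSwap) : e.IsSwap := by
  have hφ : (φ e).cycleType = Multiset.replicate 1 2 := isSwap_iff_cycleType.1 he
  have he2 : e ^ 2 = 1 := φ.injective (by
    rw [map_pow, map_one, ← he.orderOf, pow_orderOf_eq_one])
  have hrep := cycleType_of_pow_prime_eq_one he2
  have h1 := φ.nat_card_centralizer e
  rw [nat_card_centralizer_of_cycleType_replicate hrep,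
    nat_card_centralizer_of_cycleType_replicate hφ] at h1
  have hk : e.cycleType.card ≠ 0 := fun h0 => by
    rw [Multiset.card_eq_zero, cycleType_eq_zero] at h0
    rw [h0, map_one] at hφ
    simp at hφ
  have hle := e.sum_cycleType_le
  rw [hrep, Multiset.sum_replicate, Fintype.card_fin, smul_eq_mul, mul_comm] at hle
  rw [Fintype.card_fin] at h1
  rw [isSwap_iff_cycleType, hrep, eq_one_of_centralizer_card hn6 hk hle (by simpa using h1)]
  rfl

variable {α : Type*} [DecidableEq α] {a b c d : α}

theorem exists_mem_of_not_commute_swap (h : ¬ Commute (swap a b) (swap c d)) :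
    (a = c ∨ a = d) ∨ (b = c ∨ b = d) := by
  by_contra! hne
  refine h (Equiv.ext fun x => ?_)
  simp only [Perm.mul_apply, swap_apply_def]
  grind

theorem notMem_of_commute_swap (hab : a ≠ b) (hcd : c ≠ d) (h : Commute (swap a b) (swap c d))
    (hne : swap a b ≠ swap c d) : a ≠ c ∧ a ≠ d := by
  have key : ∀ {a b d : α}, a ≠ b → a ≠ d → Commute (swap a b) (swap a d) → b = d := by
    intro a b d hab had h
    by_contra hbd
    have := congrArg (fun e : Perm α => e d) h.eq
    simp only [Perm.mul_apply, swap_apply_right, swap_apply_left,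
      swap_apply_of_ne_of_ne had.symm (Ne.symm hbd)] at this
    exact hab this.symm
  constructor
  · rintro rfl
    exact hne (by rw [key hab hcd h])
  · rintro rfl
    rw [swap_comm c a] at h hne
    exact hne (by rw [key hab hcd.symm h])

end Equiv.Perm

/-! ### Transpositions along a path -/

namespace IsArtin

open Equiv in
/-- Transpositions satisfying the Artin relations run along a path. -/
theorem exists_path {α : Type*} [DecidableEq α] {N : ℕ} {t : ℕ → Perm α} (h : IsArtin N t)
    (ht : Set.InjOn t (Set.Iio N)) (hs : ∀ i < N, (t i).IsSwap) (M : ℕ) (hM : 2 ≤ M)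
    (hMN : M ≤ N) : ∃ p : ℕ → α, Set.InjOn p (Set.Iic M) ∧
      ∀ i < M, t i = swap (p i) (p (i + 1)) := by
  induction M, hM using Nat.le_induction with
  | base =>
    obtain ⟨x, y, z, hxy, hyz, hxz, h0, h1⟩ : ∃ x y z : α, x ≠ y ∧ y ≠ z ∧ x ≠ z ∧
        t 0 = swap x y ∧ t 1 = swap y z := by
      obtain ⟨a, b, hab, h0⟩ := hs 0 (by omega)
      obtain ⟨c, d, hcd, h1⟩ := hs 1 (by omega)
      have hnc := h.not_commute_succ ht (i := 0) (by omega)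
      rw [zero_add, h0, h1] at hnc
      have hne : swap a b ≠ swap c d := fun e => hnc (e ▸ Commute.refl _)
      rcases Perm.exists_mem_of_not_commute_swap hnc with (rfl | rfl) | (rfl | rfl)
      · exact ⟨b, a, d, hab.symm, hcd, by rintro rfl; exact hne rfl, by rw [h0, swap_comm], h1⟩
      · exact ⟨b, a, c, hab.symm, hcd.symm, by rintro rfl; exact hne (swap_comm _ _),
          by rw [h0, swap_comm], by rw [h1, swap_comm]⟩
      · exact ⟨a, b, d, hab, hcd, by rintro rfl; exact hne (swap_comm _ _), h0, h1⟩
      · exact ⟨a, b, c, hab, hcd.symm, by rintro rfl; exact hne rfl, h0, by rw [h1, swap_comm]⟩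
    refine ⟨fun i => if i = 0 then x else if i = 1 then y else z, ?_, ?_⟩
    · intro i hi j hj hij
      simp only [Set.mem_Iic] at hi hj
      interval_cases i <;> interval_cases j <;> simp_all
    · intro i hi
      interval_cases i <;> simp_all
  | succ M hM ih =>
    obtain ⟨p, hp, hpt⟩ := ih (by omega)
    have hp' : ∀ i j, i ≤ M → j ≤ M → p i = p j → i = j := fun i j hi hj e => hp hi hj e
    obtain ⟨d, hd, hMd⟩ : ∃ d, (∀ i ≤ M, p i ≠ d) ∧ t M = swap (p M) d := by
      obtain ⟨c, d, hcd, htM⟩ := hs M (by omega)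
      -- Commuting distinct transpositions are disjoint, so `t M` can meet the path only at its end
      -- `p M`.
      have far : ∀ i, i + 1 < M → (p i ≠ c ∧ p i ≠ d) ∧ (p (i + 1) ≠ c ∧ p (i + 1) ≠ d) := by
        intro i hi
        have hc := h.comm i M hi (by omega)
        have hne : t i ≠ t M := fun e => by
          have := ht (show i ∈ Set.Iio N by simp; omega) (show M ∈ Set.Iio N by simp; omega) e
          omega
        have hpp : p i ≠ p (i + 1) := fun e => by
          have := hp' i (i + 1) (by omega) (by omega) e
          omega
        rw [hpt i (by omega), htM] at hc hne
        refine ⟨Perm.notMem_of_commute_swap hpp hcd hc hne, ?_⟩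
        rw [swap_comm] at hc hne
        exact Perm.notMem_of_commute_swap hpp.symm hcd hc hne
      have far' : ∀ i < M, p i ≠ c ∧ p i ≠ d := by
        intro i hi
        by_cases h1 : i + 1 < M
        · exact (far i h1).1
        · have := (far (i - 1) (by omega)).2
          rwa [show i - 1 + 1 = i by omega] at this
      have hnc := h.not_commute_succ ht (i := M - 1) (by omega)
      rw [hpt (M - 1) (by omega), show M - 1 + 1 = M by omega, htM] at hnc
      have hMem : p M = c ∨ p M = d := by
        have := far' (M - 1) (by omega)
        exact (Perm.exists_mem_of_not_commute_swap hnc).resolve_left (by tauto)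
      rcases hMem with hMc | hMd
      · refine ⟨d, fun i hi => ?_, by rw [htM, hMc]⟩
        rcases Nat.lt_or_eq_of_le hi with hlt | rfl
        · exact (far' i hlt).2
        · rw [hMc]; exact hcd
      · refine ⟨c, fun i hi => ?_, by rw [htM, hMd, swap_comm]⟩
        rcases Nat.lt_or_eq_of_le hi with hlt | rfl
        · exact (far' i hlt).1
        · rw [hMd]; exact hcd.symm
    refine ⟨fun i => if i ≤ M then p i else d, ?_, ?_⟩
    · intro i hi j hj hij
      simp only [Set.mem_Iic] at hi hj
      by_cases hiM : i ≤ M <;> by_cases hjM : j ≤ M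
      · simp only [hiM, hjM, if_true] at hij
        exact hp' i j hiM hjM hij
      · simp only [hiM, hjM, if_true, if_false] at hij
        exact absurd hij (hd i hiM)
      · simp only [hiM, hjM, if_true, if_false] at hij
        exact absurd hij.symm (hd j hjM)
      · omega
    · intro i hi
      rcases Nat.lt_or_eq_of_le (Nat.le_of_lt_succ hi) with hlt | rfl
      · simp only [hlt.le, if_true, show i + 1 ≤ M from hlt]
        exact hpt i hlt
      · simpa using hMd

end IsArtin

/-! ### Classification for n ≠ 4 -/

namespace BraidGroup

variable {n : ℕ}

theorem homConjugate_toPerm (hn : 3 ≤ n) (h4 : n ≠ 4) (h6 : n ≠ 6)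
    {f : BraidGroup n →* Equiv.Perm (Fin n)} (hf : Function.Surjective f)
    (hφ : QuotientEquivalent f (toPerm n)) : HomConjugate f (toPerm n) := by
  obtain ⟨φ, hφ⟩ := hφ
  have hs : ∀ i < n - 1, (genSeq f i).IsSwap := fun i hi => by
    refine Equiv.Perm.isSwap_of_mulEquiv h6 φ ?_
    rw [genSeq_of_lt f hi, hφ, ← genSeq_of_lt _ hi, genSeq_toPerm hi]
    exact ⟨_, _, by simp, rfl⟩
  obtain ⟨p, hp, hpt⟩ := (isArtin_genSeq f).exists_path
    (injOn_genSeq hf (not_isCyclic_perm hn) fun h => absurd h h4) hs (n - 1) (by omega) le_rfl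
  have hinj : Function.Injective fun i : Fin n => p i := fun i j hij =>
    Fin.ext (hp (by have := i.2; simp; omega) (by have := j.2; simp; omega) hij)
  -- The path visits all `n` points, so its vertices form a permutation carrying the standard path
  -- to it.
  let τ : Equiv.Perm (Fin n) := Equiv.ofBijective _ (Finite.injective_iff_bijective.1 hinj)
  refine ⟨τ, fun b => ?_⟩
  suffices f = (MulAut.conj τ).toMonoidHom.comp (toPerm n) from DFunLike.congr_fun this b
  refine hom_ext fun i => ?_
  rw [← genSeq_of_lt f i.2, hpt i i.2]
  change _ = τ * toPerm n (σ i) * τ⁻¹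
  rw [← genSeq_of_lt _ i.2, genSeq_toPerm i.2, ← Equiv.swap_apply_apply]
  rfl

theorem nat_card_perm_fin (n : ℕ) : Nat.card (Equiv.Perm (Fin n)) = n.factorial := by
  rw [Nat.card_perm, Nat.card_fin]

theorem toPerm_isMinimalNoncyclicQuotient (hn : 3 ≤ n) (h4 : n ≠ 4) :
    IsMinimalNoncyclicQuotient (toPerm n) :=
  isMinimalNoncyclicQuotient_of_card (toPerm_isNoncyclicQuotient hn) fun H _ _ g hg => by
    rw [nat_card_perm_fin]
    exact factorial_le_card hg.1 hg.2 hn fun h => absurd h h4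

theorem quotientEquivalent_toPerm (hn : 3 ≤ n) (h4 : n ≠ 4) {G : Type u} [Group G] [Finite G]
    {f : BraidGroup n →* G} (hf : IsNoncyclicQuotient f) (hG : Nat.card G ≤ n.factorial) :
    QuotientEquivalent f (toPerm n) := by
  have hG' : Nat.card G = n.factorial :=
    le_antisymm hG (factorial_le_card hf.1 hf.2 hn fun h => absurd h h4)
  exact quotientEquivalent_of_card hf.1 (toPerm_surjective n) (by omega)
    (genSeq_mul_self hf.1 hf.2 hn h4 hG')
    (genSeq_mul_self (toPerm_surjective n) (not_isCyclic_perm hn) hn h4 (nat_card_perm_fin n))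
    hG' (nat_card_perm_fin n)

/-! ### Four strands, by restriction to three -/

/-- The inclusion of the braid group on three strands. -/
def threeToFour : BraidGroup 3 →* BraidGroup 4 :=
  lift (n := 3) (fun i => (σ ⟨i, by omega⟩ : BraidGroup 4)) (fun _ _ h => σ_braid _ _ h)
    (fun _ _ h => σ_comm _ _ h)

theorem threeToFour_σ (i : Fin (3 - 1)) :
    threeToFour (σ i) = (σ ⟨i, by omega⟩ : BraidGroup 4) := lift_σ _ _ _ _

theorem genSeq_comp_threeToFour {G : Type*} [Group G] (f : BraidGroup 4 →* G) {i : ℕ} (hi : i < 2) :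
    genSeq (f.comp threeToFour) i = genSeq f i := by
  rw [genSeq_of_lt _ hi, genSeq_of_lt f (show i < 4 - 1 by omega), MonoidHom.comp_apply,
    threeToFour_σ]

theorem eq_of_comp_threeToFour_eq {G : Type*} [Group G] {f g : BraidGroup 4 →* G}
    (hf : genSeq f 0 = genSeq f 2) (hg : genSeq g 0 = genSeq g 2)
    (h : f.comp threeToFour = g.comp threeToFour) : f = g := by
  refine hom_ext fun i => ?_
  rw [← genSeq_of_lt f i.2, ← genSeq_of_lt g i.2]
  have h0 : ∀ j < 2, genSeq f j = genSeq g j := fun j hj => by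
    rw [← genSeq_comp_threeToFour f hj, h, genSeq_comp_threeToFour g hj]
  by_cases hi : (i : ℕ) < 2
  · exact h0 i hi
  · rw [show (i : ℕ) = 2 by omega, ← hf, ← hg]
    exact h0 0 (by omega)

theorem surjective_comp_threeToFour {G : Type*} [Group G] {f : BraidGroup 4 →* G}
    (hf : Function.Surjective f) (h : genSeq f 0 = genSeq f 2) :
    Function.Surjective (f.comp threeToFour) := by
  rw [← MonoidHom.range_eq_top, eq_top_iff, ← MonoidHom.range_eq_top.2 hf, range_eq_closure f,
    Subgroup.closure_le]
  have h0 : ∀ j < 2, genSeq f j ∈ (f.comp threeToFour).range := fun j hj => by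
    rw [range_eq_closure, ← genSeq_comp_threeToFour f hj]
    exact Subgroup.subset_closure ⟨j, hj, rfl⟩
  rintro _ ⟨i, hi, rfl⟩
  simp only [Set.mem_Iio] at hi
  by_cases hi2 : i < 2
  · exact h0 i hi2
  · rw [show i = 2 by omega, ← h]
    exact h0 0 (by omega)

theorem genSeq_fourToPermThree : genSeq fourToPermThree 0 = genSeq fourToPermThree 2 := by
  rw [genSeq_of_lt _ (by omega), genSeq_of_lt _ (by omega), fourToPermThree, lift_σ, lift_σ]
  rfl

theorem fourToPermThree_comp : fourToPermThree.comp threeToFour = toPerm 3 := by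
  refine hom_ext fun i => ?_
  rw [MonoidHom.comp_apply, threeToFour_σ, fourToPermThree, toPerm, lift_σ, lift_σ]
  fin_cases i <;> rfl

theorem fourToPermThree_isNoncyclicQuotient : IsNoncyclicQuotient fourToPermThree := by
  refine ⟨?_, not_isCyclic_perm le_rfl⟩
  have := toPerm_surjective 3
  rw [← fourToPermThree_comp] at this
  exact Function.Surjective.of_comp this

theorem six_le_card {G : Type*} [Group G] [Finite G] {f : BraidGroup 4 →* G}
    (hf : Function.Surjective f) (hG : ¬ IsCyclic G) : 6 ≤ Nat.card G := by
  by_cases h : genSeq f 0 = genSeq f 2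
  · exact factorial_le_card (surjective_comp_threeToFour hf h) hG le_rfl (by omega)
  · exact le_trans (by decide) (factorial_le_card hf hG (by omega) fun _ => h)

theorem fourToPermThree_isMinimalNoncyclicQuotient :
    IsMinimalNoncyclicQuotient fourToPermThree :=
  isMinimalNoncyclicQuotient_of_card fourToPermThree_isNoncyclicQuotient fun H _ _ g hg => by
    rw [nat_card_perm_fin]
    exact six_le_card hg.1 hg.2

/-- Distinct images of the outer half-twists would force order at least 24, while Σ_3 is a
non-cyclic quotient of order 6. -/
theorem genSeq_eq_of_isMinimal {G : Type u} [Group G] {f : BraidGroup 4 →* G}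
    (hf : IsMinimalNoncyclicQuotient f) : genSeq f 0 = genSeq f 2 := by
  obtain ⟨_, hcard⟩ := hf.card_le fourToPermThree_isNoncyclicQuotient
  rw [nat_card_perm_fin] at hcard
  by_contra h
  have := (factorial_le_card hf.1.1 hf.1.2 (by omega) fun _ => h).trans hcard
  revert this
  decide

theorem quotientEquivalent_comp_threeToFour {G : Type u} [Group G] {f : BraidGroup 4 →* G}
    (hf : IsMinimalNoncyclicQuotient f) :
    QuotientEquivalent (f.comp threeToFour) (toPerm 3) := by
  obtain ⟨_, hcard⟩ := hf.card_le fourToPermThree_isNoncyclicQuotient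
  rw [nat_card_perm_fin] at hcard
  exact quotientEquivalent_toPerm le_rfl (by omega)
    ⟨surjective_comp_threeToFour hf.1.1 (genSeq_eq_of_isMinimal hf), hf.1.2⟩ hcard

theorem eq_fourToPermThree {f : BraidGroup 4 →* Equiv.Perm (Fin 3)}
    (h : genSeq f 0 = genSeq f 2) (h' : f.comp threeToFour = toPerm 3) : f = fourToPermThree :=
  eq_of_comp_threeToFour_eq h genSeq_fourToPermThree (h'.trans fourToPermThree_comp.symm)

theorem genSeq_comp {G H : Type*} [Group G] [Group H] (φ : G →* H) (f : BraidGroup n →* G)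
    (i : ℕ) : genSeq (φ.comp f) i = φ (genSeq f i) := by
  simp only [genSeq]
  split_ifs <;> simp

theorem quotientEquivalent_fourToPermThree {G : Type u} [Group G] {f : BraidGroup 4 →* G}
    (hf : IsMinimalNoncyclicQuotient f) : QuotientEquivalent f fourToPermThree := by
  obtain ⟨φ, hφ⟩ := quotientEquivalent_comp_threeToFour hf
  have : φ.toMonoidHom.comp f = fourToPermThree := eq_fourToPermThree
    (by rw [genSeq_comp, genSeq_comp, genSeq_eq_of_isMinimal hf]) (MonoidHom.ext hφ)
  exact ⟨φ, DFunLike.congr_fun this⟩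

theorem homConjugate_fourToPermThree {f : BraidGroup 4 →* Equiv.Perm (Fin 3)}
    (hf : IsMinimalNoncyclicQuotient f) : HomConjugate f fourToPermThree := by
  obtain ⟨τ, hτ⟩ := homConjugate_toPerm le_rfl (by omega) (by omega)
    (surjective_comp_threeToFour hf.1.1 (genSeq_eq_of_isMinimal hf))
    (quotientEquivalent_comp_threeToFour hf)
  have : (MulAut.conj τ⁻¹).toMonoidHom.comp f = fourToPermThree := eq_fourToPermThree
    (by rw [genSeq_comp, genSeq_comp, genSeq_eq_of_isMinimal hf])
    (MonoidHom.ext fun b => by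
      change τ⁻¹ * f.comp threeToFour b * τ⁻¹⁻¹ = _
      rw [hτ]; group)
  refine ⟨τ, fun b => ?_⟩
  rw [← this]
  change _ = τ * (τ⁻¹ * f b * τ⁻¹⁻¹) * τ⁻¹
  group

end BraidGroup

theorem theorem5p1 :
    (∀ n : ℕ, 3 ≤ n → n ≠ 4 →
      IsMinimalNoncyclicQuotient (BraidGroup.toPerm n) ∧
      (∀ (G : Type u) [Group G] (f : BraidGroup n →* G),
        IsMinimalNoncyclicQuotient f → QuotientEquivalent f (BraidGroup.toPerm n)) ∧
      (n ≠ 6 → ∀ f : BraidGroup n →* Equiv.Perm (Fin n),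
        IsMinimalNoncyclicQuotient f → HomConjugate f (BraidGroup.toPerm n))) ∧
    IsMinimalNoncyclicQuotient BraidGroup.fourToPermThree ∧
    (∀ (G : Type u) [Group G] (f : BraidGroup 4 →* G),
      IsMinimalNoncyclicQuotient f → QuotientEquivalent f BraidGroup.fourToPermThree) ∧
    (∀ f : BraidGroup 4 →* Equiv.Perm (Fin 3),
      IsMinimalNoncyclicQuotient f → HomConjugate f BraidGroup.fourToPermThree) := by
  refine ⟨fun n hn h4 => ⟨BraidGroup.toPerm_isMinimalNoncyclicQuotient hn h4, ?_, ?_⟩,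
    BraidGroup.fourToPermThree_isMinimalNoncyclicQuotient,
    fun G _ f hf => BraidGroup.quotientEquivalent_fourToPermThree hf,
    fun f hf => BraidGroup.homConjugate_fourToPermThree hf⟩
  · intro G _ f hf
    obtain ⟨_, hcard⟩ := hf.card_le (BraidGroup.toPerm_isNoncyclicQuotient hn)
    rw [BraidGroup.nat_card_perm_fin] at hcard
    exact BraidGroup.quotientEquivalent_toPerm hn h4 hf.1 hcard
  · intro h6 f hf
    exact BraidGroup.homConjugate_toPerm hn h4 h6 hf.1.1
      (BraidGroup.quotientEquivalent_toPerm hn h4 hf.1 (BraidGroup.nat_card_perm_fin n).le)
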